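/- Let $K$ and $L$ be finite abstract simplicial complexes with vertex sets $V(K)$ and $V(L)$, all of whose vertices are simplices. A simplicial map is called non-degenerated if it is injective on every simplex. Let $Hom(K,L)$ be the subspace of $\prod_{v\in V(K)}\Delta^{V(L)}$ that is the union of the closed cells $c_\eta=\prod_{v\in V(K)}\Delta^{\eta(v)}$, where $\Delta^S$ denotes the simplex spanned by $S$ and $\eta$ ranges over all functions $\eta: V(K)\to 2^{V(L)}\setminus\{\emptyset\}$ such that 1. $\eta(u)\cap\eta(v)=\emptyset$ whenever $u\neq v$ and $\{u,v\}\in K$; 2. for each simplex $\sigma\in K$, the join $\ast_{v\in\sigma}\,\eta(v)$ of the $0$-dimensional complexes $\eta(v)$ is a subcomplex of $L$. A non-degenerated simplicial map $f:K\to K'$ induces a continuous map $\widehat f: Hom(K',L)\to Hom(K,L)$, $(x_w)_{w\in V(K')}\mapsto (x_{f(v)})_{v\in V(K)}$, which maps $c_\eta$ into $c_{\eta\circ f}$. Let $k\ge 0$ and let $\sigma_1\neq\sigma_2$ be adjacent $k$-dimensional simplices of $K$, that is, they share a common $(k-1)$-dimensional face $\tau$ (the empty simplex if $k=0$). Regard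 each $\sigma_i$ as the full simplex on its vertex set, let $\alpha_i:\sigma_i\to K$ be the embedding, let $\overrightarrow{\sigma_1\sigma_2}:\sigma_1\to\sigma_2$ be the perspectivity, i.e. the unique non-degenerated simplicial map that leaves $\tau$ point-wise fixed, and let $\mathcal P^L(\overrightarrow{\sigma_1\sigma_2}): Hom(\sigma_2,L)\to Hom(\sigma_1,L)$ be the map induced by it (the parallel transport). Then $$\widehat\alpha_1\;\simeq\;\mathcal P^L(\overrightarrow{\sigma_1\sigma_2})\circ\widehat\alpha_2\;:\;Hom(K,L)\to Hom(\sigma_1,L),$$ i.e. the two maps are homotopic. -/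

import Mathlib

namespace HomCx

/-- A non-degenerated simplicial map between abstract simplicial complexes: a map of the vertex
sets which takes simplices to simplices and is injective on every simplex. -/
structure NondegMap {V V' : Type*} [DecidableEq V'] (K : AbstractSimplicialComplex V)
    (K' : AbstractSimplicialComplex V') where
  /-- the underlying map of vertices -/
  toFun : V → V'
  image_mem : ∀ s : Finset V, s ∈ K → s.image toFun ∈ K'
  injOn : ∀ s : Finset V, s ∈ K → Set.InjOn toFun (s : Set V)

/-- The (non-empty) simplices of the join, over `v ∈ s`, of the `0`-dimensional complexes with
vertex sets `η v`: the non-empty subsets of the union of the sets `η v` which have at most one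
element in common with each of them. -/
def joinFaces {V W : Type*} (s : Finset V) (η : V → Finset W) : Set (Finset W) :=
  {ρ | ρ.Nonempty ∧ (ρ : Set W) ⊆ ⋃ v ∈ s, (η v : Set W) ∧
    ∀ v ∈ s, ((ρ : Set W) ∩ (η v : Set W)).Subsingleton}

/-- The multi-valued functions `η : V(K) → 2^{V(L)} ∖ {∅}` which index the cells
of `Hom(K, L)`. -/
structure IsCellIndex {V W : Type*} [DecidableEq V] (K : AbstractSimplicialComplex V)
    (L : AbstractSimplicialComplex W) (η : V → Finset W) : Prop where
  nonempty : ∀ v, (η v).Nonempty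
  disjoint : ∀ u v, u ≠ v → ({u, v} : Finset V) ∈ K → Disjoint (η u) (η v)
  join_subset : ∀ s : Finset V, s ∈ K → joinFaces s η ⊆ L.faces

/-- The geometric face `Δ^S` of the standard simplex `Δ^W`, in barycentric coordinates. -/
def geomFace {W : Type*} [Fintype W] (S : Finset W) : Set (W → ℝ) :=
  {x | x ∈ stdSimplex ℝ W ∧ ∀ w, w ∉ S → x w = 0}

/-- The closed cell `c_η = ∏_v Δ^{η v}`. -/
def cell {V W : Type*} [Fintype W] (η : V → Finset W) : Set (V → W → ℝ) :=
  {x | ∀ v, x v ∈ geomFace (η v)}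

/-- The complex `Hom(K, L)`, as the union of its closed cells in `∏_{v ∈ V(K)} Δ^{V(L)}`, with the
subspace topology. -/
def HomComplex {V W : Type*} [DecidableEq V] [Fintype W] (K : AbstractSimplicialComplex V)
    (L : AbstractSimplicialComplex W) : Set (V → W → ℝ) :=
  ⋃ η ∈ {η : V → Finset W | IsCellIndex K L η}, cell η

theorem IsCellIndex.comp {V V' W : Type*} [DecidableEq V] [DecidableEq V']
    {K : AbstractSimplicialComplex V} {K' : AbstractSimplicialComplex V'}
    {L : AbstractSimplicialComplex W} {η : V' → Finset W} (hη : IsCellIndex K' L η)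
    (f : NondegMap K K') : IsCellIndex K L (fun v => η (f.toFun v)) where
  nonempty v := hη.nonempty _
  disjoint u v huv h := by
    refine hη.disjoint _ _ (fun he => huv (f.injOn _ h (by simp) (by simp) he)) ?_
    have := f.image_mem _ h
    rwa [Finset.image_insert, Finset.image_singleton] at this
  join_subset s hs ρ hρ := by
    refine hη.join_subset _ (f.image_mem s hs) ⟨hρ.1, ?_, ?_⟩
    · intro w hw
      have := hρ.2.1 hw
      simpa using this
    · intro v hv
      obtain ⟨u, hu, rfl⟩ := Finset.mem_image.1 hv
      exact hρ.2.2 u hu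

/-- The continuous map `Hom(K', L) → Hom(K, L)` induced by a non-degenerated simplicial map
`f : K → K'`. It maps the cell indexed by `η` to the cell indexed by `η ∘ f`, and the coordinate
at the vertex `v` of the image of `x` is the coordinate of `x` at the vertex `f v`. -/
def NondegMap.induced {V V' W : Type*} [DecidableEq V] [DecidableEq V'] [Fintype W]
    {K : AbstractSimplicialComplex V} {K' : AbstractSimplicialComplex V'} (f : NondegMap K K')
    (L : AbstractSimplicialComplex W) : C(HomComplex K' L, HomComplex K L) where
  toFun x := ⟨fun v => x.1 (f.toFun v), by
    obtain ⟨x, hx⟩ := x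
    simp only [HomComplex, Set.mem_iUnion] at hx ⊢
    obtain ⟨η, hη, hxη⟩ := hx
    exact ⟨fun v => η (f.toFun v), IsCellIndex.comp hη f, fun v => hxη (f.toFun v)⟩⟩
  continuous_toFun := by
    refine Continuous.subtype_mk (continuous_pi fun v => ?_) _
    exact (continuous_apply (f.toFun v)).comp continuous_subtype_val

/-- A finite set `σ` regarded as a simplicial complex, the full simplex with vertex set `σ`. -/
abbrev simplex {V : Type*} (σ : Finset V) : AbstractSimplicialComplex {v : V // v ∈ σ} := ⊤

/-- The embedding of a simplex `σ` of `K` in `K`. -/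
def simplexEmbedding {V : Type*} [DecidableEq V] (K : AbstractSimplicialComplex V)
    (σ : Finset V) (hσ : σ ∈ K) : NondegMap (simplex σ) K where
  toFun v := v.1
  image_mem s hs := by
    have hne : s.Nonempty := hs
    refine (K.isRelLowerSet_faces hσ).2 ?_ (hne.image _)
    intro v hv
    obtain ⟨u, _, rfl⟩ := Finset.mem_image.1 hv
    exact u.2
  injOn _ _ := Subtype.val_injective.injOn

/-- `σ₁` and `σ₂` are `k`-dimensional simplices of `K` which share a common `(k-1)`-dimensional
face. For `k = 0` this face is the empty simplex, of dimension `-1`. -/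
structure Adjacent {V : Type*} (K : AbstractSimplicialComplex V) (k : ℕ)
    (σ₁ σ₂ : Finset V) : Prop where
  mem_left : σ₁ ∈ K
  mem_right : σ₂ ∈ K
  card_left : σ₁.card = k + 1
  card_right : σ₂.card = k + 1
  common_face : ∃ τ : Finset V, τ ⊆ σ₁ ∧ τ ⊆ σ₂ ∧ τ.card = k

/-- There is exactly one non-degenerated simplicial map between adjacent simplices which leaves
the vertices of the common face fixed. -/
theorem Adjacent.existsUnique {V : Type*} [DecidableEq V] {K : AbstractSimplicialComplex V}
    {k : ℕ} {σ₁ σ₂ : Finset V} (h : Adjacent K k σ₁ σ₂) :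
    ∃! p : NondegMap (simplex σ₁) (simplex σ₂),
      ∀ v : {v : V // v ∈ σ₁}, (v : V) ∈ σ₂ → (p.toFun v : V) = v := by
  have h12 : (σ₁ \ σ₂).card = (σ₂ \ σ₁).card := by
    have a := Finset.card_sdiff_add_card_inter σ₁ σ₂
    have b := Finset.card_sdiff_add_card_inter σ₂ σ₁
    rw [Finset.inter_comm] at b
    have := h.card_left
    have := h.card_right
    omega
  have h1 : (σ₂ \ σ₁).card ≤ 1 := by
    obtain ⟨τ, ht1, ht2, hc⟩ := h.common_face
    have b := Finset.card_sdiff_add_card_inter σ₂ σ₁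
    have c := Finset.card_le_card (Finset.subset_inter ht2 ht1)
    have := h.card_right
    omega
  let e := Finset.equivOfCardEq h12
  have he : ∀ v, (e v : V) ∈ σ₂ ∧ (e v : V) ∉ σ₁ := fun v => Finset.mem_sdiff.1 (e v).2
  let g : {v : V // v ∈ σ₁} → {v : V // v ∈ σ₂} := fun v =>
    if hv : (v : V) ∈ σ₂ then ⟨v, hv⟩
    else ⟨e ⟨v, Finset.mem_sdiff.2 ⟨v.2, hv⟩⟩, (he _).1⟩
  have hg : Function.Injective g := by
    rintro ⟨u, hu⟩ ⟨v, hv⟩ huv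
    by_cases h2u : u ∈ σ₂ <;> by_cases h2v : v ∈ σ₂
    · simpa [g, h2u, h2v] using huv
    · have : u = e ⟨v, Finset.mem_sdiff.2 ⟨hv, h2v⟩⟩ := by simpa [g, h2u, h2v] using huv
      exact absurd (this ▸ hu) (he _).2
    · have : e ⟨u, Finset.mem_sdiff.2 ⟨hu, h2u⟩⟩ = v := by simpa [g, h2u, h2v] using huv
      exact absurd (this ▸ hv) (he _).2
    · have : (e ⟨u, Finset.mem_sdiff.2 ⟨hu, h2u⟩⟩ : V) = e ⟨v, Finset.mem_sdiff.2 ⟨hv, h2v⟩⟩ := by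
        simpa [g, h2u, h2v] using huv
      simpa using e.injective (Subtype.ext this)
  refine ⟨⟨g, fun s hs => ?_, fun _ _ => hg.injOn⟩, fun v hv => by simp [g, hv], ?_⟩
  · have hne : s.Nonempty := hs
    exact hne.image g
  · have key : ∀ p : NondegMap (simplex σ₁) (simplex σ₂),
        (∀ v : {v : V // v ∈ σ₁}, (v : V) ∈ σ₂ → (p.toFun v : V) = v) →
        ∀ v : {v : V // v ∈ σ₁}, (v : V) ∉ σ₂ → (p.toFun v : V) ∈ σ₂ \ σ₁ := by
      intro p hp v hv
      refine Finset.mem_sdiff.2 ⟨(p.toFun v).2, fun hm => hv ?_⟩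
      have h3 : p.toFun ⟨p.toFun v, hm⟩ = p.toFun v :=
        Subtype.ext (hp ⟨p.toFun v, hm⟩ (p.toFun v).2)
      have h4 := p.injOn {⟨p.toFun v, hm⟩, v} (Finset.insert_nonempty _ _)
        (by simp) (by simp) h3
      have h5 : (p.toFun v : V) = v := congrArg Subtype.val h4
      exact h5 ▸ (p.toFun v).2
    rintro ⟨q, hq1, hq2⟩ hq
    have : q = g := by
      funext v
      by_cases hv : (v : V) ∈ σ₂
      · exact Subtype.ext ((hq v hv).trans (by simp [g, hv]))
      · refine Subtype.ext (Finset.card_le_one.1 h1 _ (key _ hq v hv) _ ?_)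
        simp only [g, dif_neg hv]
        exact (e _).2
    subst this
    rfl

/-- The perspectivity from `σ₁` to `σ₂`: the unique non-degenerated simplicial map from `σ₁` to
`σ₂` which leaves the common face `σ₁ ∩ σ₂` point-wise fixed. -/
noncomputable def perspectivity {V : Type*} [DecidableEq V] {K : AbstractSimplicialComplex V}
    {k : ℕ} {σ₁ σ₂ : Finset V} (h : Adjacent K k σ₁ σ₂) :
    NondegMap (simplex σ₁) (simplex σ₂) :=
  h.existsUnique.choose

/-- The parallel transport `Hom(σ₂, L) → Hom(σ₁, L)` along the perspectivity
from `σ₁` to `σ₂`. -/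
noncomputable def parallelTransport {V W : Type*} [DecidableEq V] [Fintype W]
    {K : AbstractSimplicialComplex V} {k : ℕ} {σ₁ σ₂ : Finset V} (h : Adjacent K k σ₁ σ₂)
    (L : AbstractSimplicialComplex W) :
    C(HomComplex (simplex σ₂) L, HomComplex (simplex σ₁) L) :=
  (perspectivity h).induced L

end HomCx

/-!
The perspectivity `p : σ₁ → σ₂` moves only one vertex `u`, the vertex of `σ₁` outside `σ₂`. So
`p`, followed by the inclusion of `σ₂`, and the inclusion of `σ₁` are two non-degenerated maps
`σ₁ → K` which differ only at `u`, and it suffices to show that such maps induce homotopic maps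
of `Hom` complexes (`NondegMap.induced_homotopic`). The homotopy is the straight-line one: it
stays in the `Hom` complex because, if `η₁` and `η₂` index cells and differ only at `u`, then
`v ↦ η₁ v ∪ η₂ v` indexes a cell too (`IsCellIndex.union`), and this cell contains all segments
from the cell of `η₁` to the cell of `η₂`.
-/

namespace HomCx

open scoped unitInterval

theorem IsCellIndex.union {V W : Type*} [DecidableEq V] [DecidableEq W]
    {K : AbstractSimplicialComplex V} {L : AbstractSimplicialComplex W} {η₁ η₂ : V → Finset W}
    (h₁ : IsCellIndex K L η₁) (h₂ : IsCellIndex K L η₂) (u : V)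
    (h : ∀ v, v ≠ u → η₁ v = η₂ v) : IsCellIndex K L (fun v => η₁ v ∪ η₂ v) where
  nonempty v := (h₁.nonempty v).mono Finset.subset_union_left
  disjoint a b hab hK := by
    have d₁ := h₁.disjoint a b hab hK
    have d₂ := h₂.disjoint a b hab hK
    by_cases ha : a = u
    · have hb := h b (fun hb => hab (ha.trans hb.symm))
      simp only [hb, Finset.union_idempotent, Finset.disjoint_union_left] at d₁ ⊢
      exact ⟨d₁, d₂⟩
    · simp only [h a ha, Finset.union_idempotent, Finset.disjoint_union_right] at d₁ ⊢
      exact ⟨d₁, d₂⟩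
  join_subset s hs ρ := by
    rintro ⟨hne, hsub, hsing⟩
    simp only [Finset.coe_union] at hsub hsing
    -- At `u` the simplex `ρ` has at most one vertex, so it is a simplex of one of the two joins.
    by_cases hu : ∃ a ∈ ρ, a ∈ η₂ u
    · obtain ⟨a, haρ, ha⟩ := hu
      refine h₂.join_subset s hs ⟨hne, fun b hb => ?_, fun v hv => (hsing v hv).anti
        (Set.inter_subset_inter_right _ Set.subset_union_right)⟩
      obtain ⟨v, hv, hbv⟩ := Set.mem_iUnion₂.1 (hsub hb)
      refine Set.mem_iUnion₂.2 ⟨v, hv, ?_⟩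
      by_cases hvu : v = u
      · subst hvu
        rw [hsing v hv ⟨hb, hbv⟩ ⟨haρ, Or.inr ha⟩]
        exact ha
      · simpa [h v hvu] using hbv
    · refine h₁.join_subset s hs ⟨hne, fun b hb => ?_, fun v hv => (hsing v hv).anti
        (Set.inter_subset_inter_right _ Set.subset_union_left)⟩
      obtain ⟨v, hv, hbv⟩ := Set.mem_iUnion₂.1 (hsub hb)
      refine Set.mem_iUnion₂.2 ⟨v, hv, ?_⟩
      by_cases hvu : v = u
      · subst hvu
        exact hbv.resolve_right fun hb' => hu ⟨b, hb, hb'⟩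
      · simpa [h v hvu] using hbv

theorem geomFace_union_segment {W : Type*} [Fintype W] [DecidableEq W] {S T : Finset W}
    {x y : W → ℝ} (hx : x ∈ geomFace S) (hy : y ∈ geomFace T) (t : I) :
    (1 - (t : ℝ)) • x + (t : ℝ) • y ∈ geomFace (S ∪ T) := by
  refine ⟨convex_stdSimplex ℝ W hx.1 hy.1 (sub_nonneg.2 t.2.2) t.2.1 (by ring), fun w hw => ?_⟩
  simp only [Finset.mem_union, not_or] at hw
  simp [hx.2 w hw.1, hy.2 w hw.2]

/-- Two non-degenerated simplicial maps which differ at no more than one vertex induce homotopic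
maps of `Hom` complexes, by the straight-line homotopy. -/
theorem NondegMap.induced_homotopic {V V' W : Type*} [DecidableEq V] [DecidableEq V'] [Fintype W]
    {K : AbstractSimplicialComplex V} {K' : AbstractSimplicialComplex V'} (f g : NondegMap K K')
    (L : AbstractSimplicialComplex W) (u : V) (h : ∀ v, v ≠ u → f.toFun v = g.toFun v) :
    ContinuousMap.Homotopic (f.induced L) (g.induced L) := by
  classical
  refine ⟨{
    toFun := fun p => ⟨fun v => (1 - (p.1 : ℝ)) • p.2.1 (f.toFun v) +
      (p.1 : ℝ) • p.2.1 (g.toFun v), ?_⟩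
    continuous_toFun := ?_
    map_zero_left := fun x => Subtype.ext (funext fun v => by simp [NondegMap.induced])
    map_one_left := fun x => Subtype.ext (funext fun v => by simp [NondegMap.induced]) }⟩
  · obtain ⟨t, x, hx⟩ := p
    simp only [HomComplex, Set.mem_iUnion] at hx ⊢
    obtain ⟨η, hη, hxη⟩ := hx
    exact ⟨_, IsCellIndex.union (hη.comp f) (hη.comp g) u fun v hv => congrArg η (h v hv),
      fun v => geomFace_union_segment (hxη _) (hxη _) t⟩
  · refine Continuous.subtype_mk (continuous_pi fun v => ?_) _
    have ht : Continuous fun p : I × HomComplex K' L => (p.1 : ℝ) :=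
      continuous_subtype_val.comp continuous_fst
    have hx (w : V') : Continuous fun p : I × HomComplex K' L => p.2.1 w :=
      (continuous_apply w).comp (continuous_subtype_val.comp continuous_snd)
    exact ((continuous_const.sub ht).smul (hx _)).add (ht.smul (hx _))

end HomCx

theorem proposition4p8 {V W : Type*} [Finite V] [DecidableEq V] [Fintype W]
    (K : AbstractSimplicialComplex V) (L : AbstractSimplicialComplex W)
    (k : ℕ) (σ₁ σ₂ : Finset V) (hne : σ₁ ≠ σ₂) (hadj : HomCx.Adjacent K k σ₁ σ₂) :
    ContinuousMap.Homotopic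
      ((HomCx.simplexEmbedding K σ₁ hadj.mem_left).induced L)
      ((HomCx.parallelTransport hadj L).comp
        ((HomCx.simplexEmbedding K σ₂ hadj.mem_right).induced L)) := by
  obtain ⟨u, hu₁, hu₂⟩ : ∃ u ∈ σ₁, u ∉ σ₂ := Finset.not_subset.1 fun hs =>
    hne (Finset.eq_of_subset_of_card_le hs (by rw [hadj.card_left, hadj.card_right]))
  have hcard : (σ₁ \ σ₂).card ≤ 1 := by
    obtain ⟨τ, h₁, h₂, hτ⟩ := hadj.common_face
    have := Finset.card_sdiff_add_card_inter σ₁ σ₂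
    have := Finset.card_le_card (Finset.subset_inter h₁ h₂)
    have := hadj.card_left
    omega
  have hp := hadj.existsUnique.choose_spec.1
  -- The perspectivity followed by the inclusion of `σ₂`, as a map from `σ₁` to `K`.
  let g : HomCx.NondegMap (HomCx.simplex σ₁) K :=
    { toFun := fun v => ((HomCx.perspectivity hadj).toFun v : V)
      image_mem := fun s hs => by
        have := (HomCx.simplexEmbedding K σ₂ hadj.mem_right).image_mem _
          ((HomCx.perspectivity hadj).image_mem s hs)
        rwa [Finset.image_image] at this
      injOn := fun s hs a ha b hb hab =>
        (HomCx.perspectivity hadj).injOn s hs ha hb (Subtype.ext hab) }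
  refine HomCx.NondegMap.induced_homotopic
    (HomCx.simplexEmbedding K σ₁ hadj.mem_left) g L ⟨u, hu₁⟩ fun v hv => ?_
  refine (hp v (by_contra fun hv₂ => hv (Subtype.ext ?_))).symm
  exact Finset.card_le_one.1 hcard _ (Finset.mem_sdiff.2 ⟨v.2, hv₂⟩) _
    (Finset.mem_sdiff.2 ⟨hu₁, hu₂⟩)
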